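/- For integers $k\ge 1$ and $\alpha_1,\alpha_2,\alpha_3$, write $\frac1k(\alpha_1,\alpha_2,\alpha_3)$ for the diagonal matrix with entries $e^{2\pi i\alpha_1/k}, e^{2\pi i\alpha_2/k}, e^{2\pi i\alpha_3/k}$. For a finite subgroup $\Gamma\subset SU(3)$, regard $\mathbb C^3/\Gamma$ as a complex analytic space, whose functions holomorphic on an open set $W$ are the $\Gamma$-invariant holomorphic functions on the preimage of $W$ in $\mathbb C^3$. A point of $\mathbb C^3/\Gamma$ is singular if no neighbourhood of it is biholomorphic to an open subset of $\mathbb C^3$, and $\mathbb C^3/\Gamma$ has only isolated singularities if every singular point has a neighbourhood containing no other singular point. Let $k,k'$ be odd, let $0<\alpha_i<k$ and $0<\alpha'_i<k'$ be integers with $\gcd(k,\alpha_i)=\gcd(k',\alpha'_i)=1$ for $i=1,2,3$, and suppose that $\frac1k(\alpha_1,\alpha_2,\alpha_3)$ and $\frac1{k'}(\alpha'_1,\alpha'_2,\alpha'_3)$ lie in $SU(3)$. Let $\mathbb Z_k$ and $\mathbb Z_{k'}$ be the cyclic subgroups of $SU(3)$ that they generate, and let $\Gamma=\mathbb Z_k\cdot\mathbb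 Z_{k'}\subset SU(3)$ be the subgroup generated by both. 1. If the product is direct, that is, if $\mathbb Z_k\cap\mathbb Z_{k'}=\{1\}$, so that $\Gamma=\mathbb Z_k\times\mathbb Z_{k'}$, then $\mathbb C^3/\Gamma$ has only isolated singularities if and only if $\gcd(k,k')=1$. 2. If $\gcd(k,k')=1$, then $\mathbb Z_k\cap\mathbb Z_{k'}=\{1\}$, the quotient $\mathbb C^3/\Gamma$ has only isolated singularities, $\Gamma$ is isomorphic to $\mathbb Z/kk'\mathbb Z$, and there are integers $0<\gamma_i<kk'$ with $\gcd(kk',\gamma_i)=1$ for $i=1,2,3$ such that $\frac1{kk'}(\gamma_1,\gamma_2,\gamma_3)$ lies in $SU(3)$ and generates $\Gamma$. -/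

import Mathlib

noncomputable section

/-- The group `SU(3)` of special unitary complex `3 × 3` matrices. -/
abbrev SU3 : Type := Matrix.specialUnitaryGroup (Fin 3) ℂ

/-- The matrix `(1/k)(α₁, α₂, α₃)`, that is, the diagonal matrix with diagonal entries
`exp (2πi αⱼ / k)`. -/
def diagFrac (k : ℕ) (α : Fin 3 → ℕ) : Matrix (Fin 3) (Fin 3) ℂ :=
  Matrix.diagonal fun j => Complex.exp (2 * Real.pi * Complex.I * ((α j : ℂ) / (k : ℂ)))

/-- The quotient space `ℂ³/Γ` of `ℂ³` by a subgroup `Γ` of `SU(3)`, which acts by matrix-vector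
multiplication. It carries the quotient topology. -/
abbrev Orbifold (Γ : Subgroup SU3) : Type :=
  MulAction.orbitRel.Quotient Γ (Fin 3 → ℂ)

namespace Orbifold

variable (Γ : Subgroup SU3)

/-- The quotient map `ℂ³ → ℂ³/Γ`. -/
def proj (z : Fin 3 → ℂ) : Orbifold Γ := Quotient.mk (MulAction.orbitRel Γ (Fin 3 → ℂ)) z

/-- The structure sheaf of the complex analytic space `ℂ³/Γ`: a function is holomorphic on an open
set `W` when its pullback to `ℂ³` is holomorphic on the preimage of `W`; equivalently, the sections
over `W` are the `Γ`-invariant holomorphic functions on the preimage of `W`. -/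
def HolomorphicOn (f : Orbifold Γ → ℂ) (W : Set (Orbifold Γ)) : Prop :=
  DifferentiableOn ℂ (fun z => f (proj Γ z)) (proj Γ ⁻¹' W)

/-- The point `p` of `ℂ³/Γ` is nonsingular when the complex analytic space `ℂ³/Γ` is a complex
manifold of dimension three near `p`: some homeomorphism from an open neighbourhood of `p` onto an
open subset of `ℂ³` is biholomorphic, meaning that it identifies the holomorphic functions on
corresponding open sets. -/
def IsSmoothAt (p : Orbifold Γ) : Prop :=
  ∃ φ : OpenPartialHomeomorph (Orbifold Γ) (Fin 3 → ℂ), p ∈ φ.source ∧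
    ∀ W : Set (Orbifold Γ), IsOpen W → W ⊆ φ.source → ∀ f : Orbifold Γ → ℂ,
      HolomorphicOn Γ f W ↔ DifferentiableOn ℂ (fun w => f (φ.symm w)) (φ '' W)

/-- The set of singular points of `ℂ³/Γ`. -/
def singularLocus : Set (Orbifold Γ) := {p | ¬ IsSmoothAt Γ p}

/-- `ℂ³/Γ` has only isolated singularities: every singular point has an open neighbourhood that
contains no other singular point. -/
def HasOnlyIsolatedSingularities : Prop :=
  ∀ p ∈ singularLocus Γ, ∃ U : Set (Orbifold Γ), IsOpen U ∧ p ∈ U ∧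
    ∀ q ∈ U, q ∈ singularLocus Γ → q = p

end Orbifold

end

section

open Metric

theorem differentiableOn_fderiv_apply {E F : Type*}
    [NormedAddCommGroup E] [NormedSpace ℂ E] [FiniteDimensional ℂ E]
    [NormedAddCommGroup F] [NormedSpace ℂ F] [FiniteDimensional ℂ F]
    {f : E → F} {U : Set E} (hU : IsOpen U) (hf : DifferentiableOn ℂ f U) (e : E) :
    DifferentiableOn ℂ (fun z => fderiv ℂ f z e) U := by
  have : CompleteSpace F := FiniteDimensional.complete ℂ F
  have : FiniteDimensional ℝ E := FiniteDimensional.complexToReal E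
  have : FiniteDimensional ℝ F := FiniteDimensional.complexToReal F
  have : ProperSpace E := FiniteDimensional.proper ℂ E
  have : FiniteDimensional ℂ (E →L[ℂ] F) := inferInstance
  have : ProperSpace (E →L[ℂ] F) := FiniteDimensional.proper ℂ _
  borelize E
  borelize (E →L[ℂ] F)
  intro z₀ hz₀
  refine DifferentiableAt.differentiableWithinAt ?_
  obtain ⟨ρ, hρ, hball⟩ : ∃ ρ > 0, ∀ z ∈ ball z₀ (3 * ρ), z ∈ U ∧ dist (f z) (f z₀) < 1 := by
    have h1 : ∀ᶠ z in nhds z₀, z ∈ U ∧ dist (f z) (f z₀) < 1 :=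
      (hU.eventually_mem hz₀).and
        ((hf.differentiableAt (hU.mem_nhds hz₀)).continuousAt.eventually
          (ball_mem_nhds _ one_pos))
    obtain ⟨ε, hε, h⟩ := Metric.eventually_nhds_iff_ball.1 h1
    exact ⟨ε / 3, by positivity, fun z hz => h z (by convert hz using 2; ring)⟩
  set R : ℝ := ρ / (‖e‖ + 1) with hR
  have hRpos : 0 < R := by positivity
  have hRe : R * ‖e‖ < ρ := by
    rw [hR, div_mul_eq_mul_div, div_lt_iff₀ (by positivity)]
    nlinarith [norm_nonneg e]
  have hmem : ∀ x ∈ ball z₀ ρ, ∀ ζ : ℂ, ‖ζ‖ ≤ R → x + ζ • e ∈ ball z₀ (2 * ρ) := by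
    intro x hx ζ hζ
    rw [mem_ball, dist_eq_norm] at hx ⊢
    calc ‖x + ζ • e - z₀‖ = ‖(x - z₀) + ζ • e‖ := by congr 1; abel
      _ ≤ ‖x - z₀‖ + ‖ζ‖ * ‖e‖ := (norm_add_le _ _).trans_eq (by rw [norm_smul])
      _ < 2 * ρ := by nlinarith [mul_le_mul_of_nonneg_right hζ (norm_nonneg e)]
  have hsub : ball z₀ (2 * ρ) ⊆ U := fun z hz =>
    (hball z (ball_subset_ball (by linarith) hz)).1
  have hdiff : ∀ z ∈ ball z₀ (2 * ρ), HasFDerivAt f (fderiv ℂ f z) z := fun z hz =>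
    (hf.differentiableAt (hU.mem_nhds (hsub hz))).hasFDerivAt
  have hbound : ∀ z ∈ ball z₀ (2 * ρ), ‖fderiv ℂ f z‖ ≤ 2 / ρ := by
    intro z hz
    have hs : ball z ρ ⊆ ball z₀ (3 * ρ) := ball_subset_ball' (by
      rw [mem_ball] at hz; linarith)
    refine Complex.norm_fderiv_le_div_of_mapsTo_ball
      (hf.mono fun w hw => (hball w (hs hw)).1) (fun w hw => ?_) hρ
    have h1 := (hball w (hs hw)).2
    have h2 := (hball z (hs (mem_ball_self hρ))).2
    rw [mem_closedBall]
    linarith [dist_triangle_right (f w) (f z) (f z₀)]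
  have hline : ∀ x ∈ ball z₀ ρ, fderiv ℂ f x e =
      Complex.cderiv R (fun ζ : ℂ => f (x + ζ • e)) 0 := by
    intro x hx
    have hO : IsOpen ((fun ζ : ℂ => x + ζ • e) ⁻¹' ball z₀ (2 * ρ)) :=
      isOpen_ball.preimage (by fun_prop)
    rw [Complex.cderiv_eq_deriv hO (f := fun ζ : ℂ => f (x + ζ • e)) ?_ hRpos ?_]
    · have h0 : x + (0 : ℂ) • e ∈ ball z₀ (2 * ρ) := hmem x hx 0 (by simpa using hRpos.le)
      have h1 : HasDerivAt (fun ζ : ℂ => x + ζ • e) e 0 := by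
        simpa using ((hasDerivAt_id (0 : ℂ)).smul_const e).const_add x
      have h2 := (hdiff _ h0).comp_hasDerivAt (0 : ℂ) h1
      rw [zero_smul, add_zero] at h2
      exact h2.deriv.symm
    · intro ζ hζ
      exact (((hdiff _ hζ).differentiableAt).comp ζ (by fun_prop)).differentiableWithinAt
    · intro ζ hζ
      exact hmem x hx ζ (by simpa using hζ)
  have hev : (fun z => fderiv ℂ f z e) =ᶠ[nhds z₀]
      fun x => Complex.cderiv R (fun ζ : ℂ => f (x + ζ • e)) 0 :=
    Filter.eventually_of_mem (ball_mem_nhds z₀ hρ) hline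
  refine DifferentiableAt.congr_of_eventuallyEq ?_ hev
  simp only [Complex.cderiv, circleIntegral]
  refine DifferentiableAt.const_smul ?_ _
  set c : ℝ → ℂ := fun θ => deriv (circleMap 0 R) θ * ((circleMap 0 R θ - 0) ^ 2)⁻¹ with hc
  have hcc : Continuous c := by
    rw [hc]
    simp only [deriv_circleMap, sub_zero]
    refine Continuous.mul (by fun_prop) (Continuous.inv₀ (by fun_prop) fun θ => ?_)
    exact pow_ne_zero _ (circleMap_ne_center hRpos.ne')
  have hcm : ∀ θ, ‖circleMap 0 R θ‖ ≤ R := fun θ => by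
    simp [abs_of_pos hRpos]
  have hFcont : ∀ x ∈ ball z₀ ρ,
      Continuous fun θ => c θ • f (x + circleMap 0 R θ • e) := by
    intro x hx
    refine hcc.smul (continuous_iff_continuousAt.2 fun θ => ?_)
    exact ContinuousAt.comp (f := fun θ => x + circleMap 0 R θ • e)
      (hdiff _ (hmem x hx _ (hcm θ))).continuousAt
      (Continuous.continuousAt (by fun_prop))
  have key := intervalIntegral.hasFDerivAt_integral_of_dominated_of_fderiv_le (𝕜 := ℂ)
    (μ := MeasureTheory.volume) (a := 0) (b := 2 * Real.pi) (x₀ := z₀) (s := ball z₀ ρ)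
    (F := fun x θ => c θ • f (x + circleMap 0 R θ • e))
    (F' := fun x θ => c θ • fderiv ℂ f (x + circleMap 0 R θ • e))
    (bound := fun θ => ‖c θ‖ * (2 / ρ)) (ball_mem_nhds z₀ hρ)
    (Filter.eventually_of_mem (ball_mem_nhds z₀ hρ) fun x hx =>
      (hFcont x hx).aestronglyMeasurable)
    ((hFcont z₀ (mem_ball_self hρ)).intervalIntegrable _ _)
    (by
      refine (hcc.aestronglyMeasurable).smul ?_
      exact ((measurable_fderiv ℂ f).comp (Continuous.measurable
        (by fun_prop : Continuous fun θ => z₀ + circleMap 0 R θ • e))).aestronglyMeasurable)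
    (Filter.Eventually.of_forall fun θ _ x hx => by
      rw [norm_smul]
      exact mul_le_mul_of_nonneg_left (hbound _ (hmem x hx _ (hcm θ))) (norm_nonneg _))
    (Continuous.intervalIntegrable (by fun_prop) _ _)
    (Filter.Eventually.of_forall fun θ _ x hx => by
      exact ((hasFDerivAt_comp_add_right _).2
        (hdiff _ (hmem x hx _ (hcm θ)))).const_smul (c θ))
  refine key.differentiableAt.congr_of_eventuallyEq (Filter.Eventually.of_forall fun x => ?_)
  simp only [hc, smul_smul]

/-- A holomorphic function of two variables has no isolated zeros. -/
theorem ne_zero_of_forall_ne_zero {f : ℂ × ℂ → ℂ} {U : Set (ℂ × ℂ)} (hU : IsOpen U)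
    (hf : DifferentiableOn ℂ f U) (h0 : (0 : ℂ × ℂ) ∈ U)
    (hne : ∀ p ∈ U, p ≠ 0 → f p ≠ 0) : f 0 ≠ 0 := by
  obtain ⟨r, hr, hrU⟩ := Metric.isOpen_iff.1 hU 0 h0
  set R := r / 2 with hR
  have hRpos : 0 < R := by positivity
  have hmem : ∀ u v : ℂ, ‖u‖ ≤ R → ‖v‖ ≤ R → (u, v) ∈ U := fun u v hu hv => hrU (by
    rw [mem_ball_zero_iff, Prod.norm_def]
    exact (max_le hu hv).trans_lt (by linarith))
  have hcont : ContinuousOn f U := hf.continuousOn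
  have hK : IsCompact (sphere (0 : ℂ) R ×ˢ closedBall (0 : ℂ) R) :=
    (isCompact_sphere _ _).prod (isCompact_closedBall _ _)
  have hKU : sphere (0 : ℂ) R ×ˢ closedBall (0 : ℂ) R ⊆ U := by
    rintro ⟨u, v⟩ ⟨hu, hv⟩
    exact hmem u v (by simpa using (mem_sphere_zero_iff_norm.1 hu).le) (by simpa using hv)
  have hKne : ∀ p ∈ sphere (0 : ℂ) R ×ˢ closedBall (0 : ℂ) R, f p ≠ 0 := by
    rintro ⟨u, v⟩ hp
    refine hne _ (hKU hp) fun h => ?_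
    have hu := mem_sphere_zero_iff_norm.1 hp.1
    simp only [Prod.mk_eq_zero] at h
    simp [h.1] at hu
    linarith
  obtain ⟨C, hC⟩ := hK.exists_bound_of_continuousOn
    ((hcont.mono hKU).inv₀ hKne)
  have hCpos : 0 < C := by
    have hp : (((R : ℂ), (0 : ℂ)) : ℂ × ℂ) ∈ sphere (0 : ℂ) R ×ˢ closedBall (0 : ℂ) R := by
      simp [abs_of_pos hRpos, hRpos.le]
    exact (norm_pos_iff.2 (inv_ne_zero (hKne _ hp))).trans_le (hC _ hp)
  have hlow : ∀ v : ℂ, v ≠ 0 → ‖v‖ ≤ R → C⁻¹ ≤ ‖f (0, v)‖ := by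
    intro v hv hvR
    have hd : DiffContOnCl ℂ (fun u : ℂ => (f (u, v))⁻¹) (ball 0 R) := by
      refine DifferentiableOn.diffContOnCl ?_
      rw [closure_ball _ hRpos.ne']
      intro u hu
      have hu' : (u, v) ∈ U := hmem u v (by simpa using hu) hvR
      have h1 : DifferentiableAt ℂ (fun u : ℂ => f (u, v)) u :=
        DifferentiableAt.comp u (hf.differentiableAt (hU.mem_nhds hu')) (by fun_prop)
      exact (h1.inv (hne _ hu' (by simp [hv]))).differentiableWithinAt
    have h2 := Complex.norm_le_of_forall_mem_frontier_norm_le isBounded_ball hd (C := C)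
      (fun u hu => hC (u, v) ⟨by rwa [frontier_ball _ hRpos.ne'] at hu, by simpa using hvR⟩)
      (z := 0) (subset_closure (mem_ball_self hRpos))
    rw [norm_inv] at h2
    exact inv_le_of_inv_le₀ (norm_pos_iff.2 (hne _ (hmem 0 v (by simpa using hRpos.le) hvR)
      (by simp [hv]))) h2
  have hct : Filter.Tendsto (fun v : ℂ => ‖f (0, v)‖) (nhdsWithin 0 {0}ᶜ) (nhds ‖f 0‖) := by
    have h1 : ContinuousAt (fun v : ℂ => ‖f (0, v)‖) 0 :=
      (ContinuousAt.comp (f := fun v : ℂ => ((0 : ℂ), v)) (x := 0)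
        (hcont.continuousAt (hU.mem_nhds h0)) (by fun_prop)).norm
    exact h1.tendsto.mono_left nhdsWithin_le_nhds
  have hle : C⁻¹ ≤ ‖f 0‖ := by
    refine ge_of_tendsto hct ?_
    filter_upwards [self_mem_nhdsWithin,
      nhdsWithin_le_nhds (closedBall_mem_nhds (0 : ℂ) hRpos)] with v hv hvR
    exact hlow v hv (by simpa using hvR)
  exact norm_pos_iff.1 ((inv_pos.2 hCpos).trans_le hle)

end

instance : ContinuousConstSMul SU3 (Fin 3 → ℂ) where
  continuous_const_smul γ :=
    (Continuous.matrix_mulVec continuous_const continuous_id :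
      Continuous fun z : Fin 3 → ℂ => (γ : Matrix (Fin 3) (Fin 3) ℂ).mulVec z)

instance (Γ : Subgroup SU3) : ContinuousConstSMul Γ (Fin 3 → ℂ) where
  continuous_const_smul γ := continuous_const_smul (γ : SU3)

namespace Orbifold

/-- The action of an element of `SU(3)` on `ℂ³`, as a continuous linear map. -/
noncomputable def actionCLM (γ : SU3) : (Fin 3 → ℂ) →L[ℂ] (Fin 3 → ℂ) :=
  LinearMap.toContinuousLinearMap (Matrix.mulVecLin (γ : Matrix (Fin 3) (Fin 3) ℂ))

theorem actionCLM_apply (γ : SU3) (z : Fin 3 → ℂ) : actionCLM γ z = γ • z := rfl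

theorem eq_one_of_actionCLM_eq_id {γ : SU3} (h : actionCLM γ = ContinuousLinearMap.id ℂ _) :
    γ = 1 := by
  apply Subtype.ext
  apply Matrix.mulVec_injective
  funext z
  simpa [actionCLM] using congrArg (fun L => L z) h

variable {Γ : Subgroup SU3}

theorem isOpenQuotientMap_proj : IsOpenQuotientMap (proj Γ) :=
  MulAction.isOpenQuotientMap_quotientMk

theorem proj_eq_proj_iff {z w : Fin 3 → ℂ} : proj Γ z = proj Γ w ↔ ∃ γ ∈ Γ, γ • w = z := by
  unfold proj
  rw [Quotient.eq]
  exact ⟨fun ⟨γ, h⟩ => ⟨γ, γ.2, h⟩, fun ⟨γ, hγ, h⟩ => ⟨⟨γ, hγ⟩, h⟩⟩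

theorem proj_smul {γ : SU3} (hγ : γ ∈ Γ) (z : Fin 3 → ℂ) : proj Γ (γ • z) = proj Γ z :=
  proj_eq_proj_iff.2 ⟨γ, hγ, rfl⟩

theorem exists_isOpen_injOn_proj (hΓ : (Γ : Set SU3).Finite) {z : Fin 3 → ℂ}
    (hz : ∀ γ ∈ Γ, γ • z = z → γ = 1) :
    ∃ V : Set (Fin 3 → ℂ), IsOpen V ∧ z ∈ V ∧ Set.InjOn (proj Γ) V := by
  have h1 : ∀ γ ∈ (Γ : Set SU3), ∀ᶠ p : (Fin 3 → ℂ) × (Fin 3 → ℂ) in nhds (z, z),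
      γ • p.2 = p.1 → p.1 = p.2 := by
    intro γ hγ
    by_cases h : γ = 1
    · exact Filter.Eventually.of_forall fun p hp => by simpa [h] using hp.symm
    · have h2 : γ • z ≠ z := fun h' => h (hz γ hγ h')
      have h3 : ContinuousAt (fun p : (Fin 3 → ℂ) × (Fin 3 → ℂ) => (γ • p.2, p.1)) (z, z) :=
        Continuous.continuousAt ((continuous_snd.const_smul γ).prodMk continuous_fst)
      have h4 : ∀ᶠ q : (Fin 3 → ℂ) × (Fin 3 → ℂ) in nhds (γ • z, z), q.1 ≠ q.2 :=
        (isOpen_ne_fun continuous_fst continuous_snd).mem_nhds h2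
      filter_upwards [h3.eventually h4] with p hp hp' using absurd hp' hp
  have h2 := (Filter.eventually_all_finite hΓ).2 h1
  obtain ⟨A, B, hA, hzA, hB, hzB, hAB⟩ := mem_nhds_prod_iff'.1 h2
  refine ⟨A ∩ B, hA.inter hB, ⟨hzA, hzB⟩, fun x hx y hy hxy => ?_⟩
  obtain ⟨γ, hγ, h⟩ := proj_eq_proj_iff.1 hxy
  exact hAB (Set.mk_mem_prod hx.1 hy.2) γ hγ h

/-- On a subset of the image of an open set `V`, holomorphy can be tested on `V`. -/
theorem holomorphicOn_iff {V : Set (Fin 3 → ℂ)} (hV : IsOpen V) {W : Set (Orbifold Γ)}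
    (hW : IsOpen W) (hWV : W ⊆ proj Γ '' V) (f : Orbifold Γ → ℂ) :
    HolomorphicOn Γ f W ↔ DifferentiableOn ℂ (fun z => f (proj Γ z)) (V ∩ proj Γ ⁻¹' W) := by
  have hO : IsOpen (V ∩ proj Γ ⁻¹' W) :=
    hV.inter (hW.preimage isOpenQuotientMap_proj.continuous)
  refine ⟨fun h => h.mono Set.inter_subset_right, fun h z hz => ?_⟩
  obtain ⟨x, hx, hxz⟩ := hWV hz
  obtain ⟨γ, hγ, rfl⟩ := proj_eq_proj_iff.1 hxz
  have h1 : DifferentiableAt ℂ (fun z => f (proj Γ z)) (actionCLM γ z) := by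
    refine h.differentiableAt (hO.mem_nhds ⟨hx, ?_⟩)
    rw [Set.mem_preimage, actionCLM_apply, proj_smul hγ]
    exact hz
  have h2 := h1.comp z (actionCLM γ).differentiableAt
  have h3 : ((fun z => f (proj Γ z)) ∘ actionCLM γ) = fun z => f (proj Γ z) := by
    funext w
    simp only [Function.comp_apply, actionCLM_apply, proj_smul hγ]
  rw [h3] at h2
  exact h2.differentiableWithinAt

theorem isSmoothAt_proj (hΓ : (Γ : Set SU3).Finite) {z : Fin 3 → ℂ}
    (hz : ∀ γ ∈ Γ, γ • z = z → γ = 1) : IsSmoothAt Γ (proj Γ z) := by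
  obtain ⟨V, hV, hzV, hinj⟩ := exists_isOpen_injOn_proj hΓ hz
  let ψ : OpenPartialHomeomorph (Fin 3 → ℂ) (Orbifold Γ) :=
    OpenPartialHomeomorph.ofContinuousOpen (hinj.toPartialEquiv (proj Γ) V)
      isOpenQuotientMap_proj.continuous.continuousOn isOpenQuotientMap_proj.isOpenMap hV
  refine ⟨ψ.symm, ⟨z, hzV, rfl⟩, fun W hW hWV f => ?_⟩
  rw [holomorphicOn_iff hV hW hWV f, ψ.symm.image_eq_target_inter_inv_preimage hWV]
  rfl

section Chart

variable {φ : OpenPartialHomeomorph (Orbifold Γ) (Fin 3 → ℂ)}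

theorem differentiableOn_chart_comp_proj
    (hφ : ∀ W : Set (Orbifold Γ), IsOpen W → W ⊆ φ.source → ∀ f : Orbifold Γ → ℂ,
      HolomorphicOn Γ f W ↔ DifferentiableOn ℂ (fun w => f (φ.symm w)) (φ '' W)) :
    DifferentiableOn ℂ (fun z => φ (proj Γ z)) (proj Γ ⁻¹' φ.source) := by
  rw [differentiableOn_pi]
  intro i
  refine (hφ φ.source φ.open_source subset_rfl (fun q => φ q i)).2 ?_
  rw [φ.image_source_eq_target]
  refine DifferentiableOn.congr (f := fun w => w i) (by fun_prop) fun w hw => ?_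
  rw [φ.right_inv hw]

theorem injective_fderiv_chart_comp_proj (hΓ : (Γ : Set SU3).Finite)
    (hφ : ∀ W : Set (Orbifold Γ), IsOpen W → W ⊆ φ.source → ∀ f : Orbifold Γ → ℂ,
      HolomorphicOn Γ f W ↔ DifferentiableOn ℂ (fun w => f (φ.symm w)) (φ '' W))
    {z : Fin 3 → ℂ} (hzφ : proj Γ z ∈ φ.source) (hz : ∀ γ ∈ Γ, γ • z = z → γ = 1) :
    Function.Injective (fderiv ℂ (fun z => φ (proj Γ z)) z) := by
  obtain ⟨V, hV, hzV, hinj⟩ := exists_isOpen_injOn_proj hΓ hz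
  have hcont : Continuous (proj Γ) := isOpenQuotientMap_proj.continuous
  set W : Set (Orbifold Γ) := proj Γ '' V ∩ φ.source with hWdef
  have hW : IsOpen W := (isOpenQuotientMap_proj.isOpenMap V hV).inter φ.open_source
  have hzW : proj Γ z ∈ W := ⟨⟨z, hzV, rfl⟩, hzφ⟩
  let s : Orbifold Γ → (Fin 3 → ℂ) := Function.invFunOn (proj Γ) V
  have hs : ∀ x ∈ V, s (proj Γ x) = x := fun x hx => hinj.leftInvOn_invFunOn hx
  have hsφ : DifferentiableOn ℂ (fun w => s (φ.symm w)) (φ '' W) := by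
    rw [differentiableOn_pi]
    intro i
    refine (hφ W hW Set.inter_subset_right fun q => s q i).1 ?_
    rw [holomorphicOn_iff hV hW Set.inter_subset_left]
    refine DifferentiableOn.congr (f := fun w => w i) (by fun_prop) fun w hw => ?_
    rw [hs w hw.1]
  have hφW : IsOpen (φ '' W) := φ.isOpen_image_of_subset_source hW Set.inter_subset_right
  have h1 : DifferentiableAt ℂ (fun w => s (φ.symm w)) (φ (proj Γ z)) :=
    hsφ.differentiableAt (hφW.mem_nhds ⟨_, hzW, rfl⟩)
  have h2 : DifferentiableAt ℂ (fun z => φ (proj Γ z)) z :=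
    (differentiableOn_chart_comp_proj hφ).differentiableAt
      ((φ.open_source.preimage hcont).mem_nhds hzφ)
  have h3 := h1.hasFDerivAt.comp z h2.hasFDerivAt
  have h4 : ((fun w => s (φ.symm w)) ∘ fun z => φ (proj Γ z)) =ᶠ[nhds z] id := by
    filter_upwards [hV.mem_nhds hzV, (φ.open_source.preimage hcont).mem_nhds hzφ] with x hx hx'
    simp only [Function.comp_apply, φ.left_inv hx', hs x hx, id]
  have h5 := (h3.congr_of_eventuallyEq h4.symm).unique (hasFDerivAt_id z)
  refine Function.LeftInverse.injective
    (g := fderiv ℂ (fun w => s (φ.symm w)) (φ (proj Γ z))) fun v => ?_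
  simpa using congrArg (fun L => L v) h5

end Chart

/-- A fixed point of a nontrivial group element is singular if it is an isolated point with
nontrivial stabilizer in some affine plane through it. -/
theorem not_isSmoothAt_proj (hΓ : (Γ : Set SU3).Finite) {z e e' : Fin 3 → ℂ} {h : SU3}
    (hh : h ∈ Γ) (hne : h ≠ 1) (hfix : h • z = z)
    (hfree : ∀ a b : ℂ, (a, b) ≠ 0 → ∀ γ ∈ Γ,
      γ • (z + a • e + b • e') = z + a • e + b • e' → γ = 1) :
    ¬ IsSmoothAt Γ (proj Γ z) := by
  rintro ⟨φ, hzφ, hφ⟩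
  set F : (Fin 3 → ℂ) → (Fin 3 → ℂ) := fun z => φ (proj Γ z) with hF
  have hcont : Continuous (proj Γ) := isOpenQuotientMap_proj.continuous
  have hU : IsOpen (proj Γ ⁻¹' φ.source) := φ.open_source.preimage hcont
  have hFd : DifferentiableOn ℂ F (proj Γ ⁻¹' φ.source) := differentiableOn_chart_comp_proj hφ
  let M : (Fin 3 → ℂ) → Matrix (Fin 3) (Fin 3) ℂ := fun x =>
    LinearMap.toMatrix' (fderiv ℂ F x : (Fin 3 → ℂ) →ₗ[ℂ] (Fin 3 → ℂ))
  have hM : ∀ x, Function.Injective (fderiv ℂ F x) ↔ (M x).det ≠ 0 := by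
    intro x
    rw [← isUnit_iff_ne_zero, ← Matrix.isUnit_iff_isUnit_det, ← Matrix.mulVec_injective_iff_isUnit]
    have : (M x).mulVec = fderiv ℂ F x := by
      funext v
      exact LinearMap.toMatrix'_mulVec _ v
    rw [this]
  have hJ : DifferentiableOn ℂ (fun x => (M x).det) (proj Γ ⁻¹' φ.source) := by
    have hent : ∀ i j, DifferentiableOn ℂ (fun x => M x i j) (proj Γ ⁻¹' φ.source) := by
      intro i j
      have := differentiableOn_pi.1 (differentiableOn_fderiv_apply hU hFd (Pi.single j 1)) i
      refine this.congr fun x _ => ?_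
      simp [M, LinearMap.toMatrix'_apply]
    simp only [Matrix.det_fin_three]
    fun_prop
  let ι : ℂ × ℂ → (Fin 3 → ℂ) := fun p => z + p.1 • e + p.2 • e'
  have hι : Differentiable ℂ ι := by fun_prop
  have hι0 : ι 0 = z := by simp [ι]
  have h1 := ne_zero_of_forall_ne_zero (f := fun p => (M (ι p)).det)
    (U := ι ⁻¹' (proj Γ ⁻¹' φ.source)) (hU.preimage hι.continuous)
    (hJ.comp hι.differentiableOn fun _ h => h) (by simpa [hι0] using hzφ)
    (fun p hp hp0 => (hM _).1
      (injective_fderiv_chart_comp_proj hΓ hφ hp (hfree p.1 p.2 hp0)))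
  rw [hι0, ← hM] at h1
  refine hne (eq_one_of_actionCLM_eq_id ?_)
  have h2 : HasFDerivAt F (fderiv ℂ F z) z :=
    (hFd.differentiableAt (hU.mem_nhds hzφ)).hasFDerivAt
  have h2' : HasFDerivAt F (fderiv ℂ F z) (actionCLM h z) := by
    rwa [actionCLM_apply, hfix]
  have h3 := h2'.comp z (actionCLM h).hasFDerivAt
  have h4 : F ∘ actionCLM h = F := by
    funext x
    simp only [hF, Function.comp_apply, actionCLM_apply, proj_smul hh]
  rw [h4] at h3
  ext1 v
  apply h1
  simpa using congrArg (fun L => L v) (h3.unique h2)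

end Orbifold

theorem smul_apply_of_coe_eq_diagonal {γ : SU3} {d : Fin 3 → ℂ}
    (h : (γ : Matrix (Fin 3) (Fin 3) ℂ) = Matrix.diagonal d) (z : Fin 3 → ℂ) (i : Fin 3) :
    (γ • z) i = d i * z i := by
  change (γ : Matrix (Fin 3) (Fin 3) ℂ).mulVec z i = _
  rw [h, Matrix.mulVec_diagonal]

theorem eq_one_of_coe_eq_diagonal {γ : SU3} {d : Fin 3 → ℂ}
    (h : (γ : Matrix (Fin 3) (Fin 3) ℂ) = Matrix.diagonal d) (hd : ∀ i, d i = 1) : γ = 1 := by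
  apply Subtype.ext
  rw [h, show d = 1 from funext hd]
  exact Matrix.diagonal_one

theorem prod_eq_one_of_coe_eq_diagonal {γ : SU3} {d : Fin 3 → ℂ}
    (h : (γ : Matrix (Fin 3) (Fin 3) ℂ) = Matrix.diagonal d) : d 0 * d 1 * d 2 = 1 := by
  have := (Matrix.mem_specialUnitaryGroup_iff.1 γ.2).2
  rwa [h, Matrix.det_diagonal, Fin.prod_univ_three] at this

theorem coe_pow_eq_diagonal {γ : SU3} {d : Fin 3 → ℂ}
    (h : (γ : Matrix (Fin 3) (Fin 3) ℂ) = Matrix.diagonal d) (n : ℕ) :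
    ((γ ^ n : SU3) : Matrix (Fin 3) (Fin 3) ℂ) = Matrix.diagonal (fun i => d i ^ n) := by
  rw [SubmonoidClass.coe_pow, h, Matrix.diagonal_pow]
  rfl

/-- The group of diagonal matrices in `SU(3)` whose entries are `N`-th roots of unity. -/
def diagonalRoots (N : ℕ) : Subgroup SU3 where
  carrier := {γ | ∃ d : Fin 3 → ℂ,
    (γ : Matrix (Fin 3) (Fin 3) ℂ) = Matrix.diagonal d ∧ ∀ i, d i ^ N = 1}
  mul_mem' := by
    rintro _ _ ⟨d, h, hd⟩ ⟨d', h', hd'⟩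
    refine ⟨fun i => d i * d' i, ?_, fun i => by rw [mul_pow, hd, hd', one_mul]⟩
    rw [Submonoid.coe_mul, h, h', Matrix.diagonal_mul_diagonal]
  one_mem' := ⟨1, Matrix.diagonal_one.symm, fun _ => one_pow N⟩
  inv_mem' := by
    rintro γ ⟨d, h, hd⟩
    refine ⟨star d, ?_, fun i => by rw [Pi.star_apply, ← star_pow, hd, star_one]⟩
    change star (γ : Matrix (Fin 3) (Fin 3) ℂ) = _
    rw [h, Matrix.star_eq_conjTranspose, Matrix.diagonal_conjTranspose]

theorem finite_diagonalRoots {N : ℕ} (hN : 0 < N) : (diagonalRoots N : Set SU3).Finite := by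
  have h1 : {x : ℂ | x ^ N = 1}.Finite := by
    refine (Polynomial.nthRootsFinset N (1 : ℂ)).finite_toSet.subset fun x hx => ?_
    exact (Polynomial.mem_nthRootsFinset hN (1 : ℂ)).2 hx
  have h2 : {d : Fin 3 → ℂ | ∀ i, d i ∈ {x : ℂ | x ^ N = 1}}.Finite := Set.Finite.pi' fun _ => h1
  refine Set.Finite.of_finite_image ((h2.image Matrix.diagonal).subset ?_)
    Subtype.val_injective.injOn
  rintro _ ⟨γ, ⟨d, h, hd⟩, rfl⟩
  exact ⟨d, hd, h.symm⟩

/-- An element of `SU(3)` is diagonal with all three entries primitive `k`-th roots of unity. -/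
def IsPrimitiveDiagonal (g : SU3) (k : ℕ) : Prop :=
  ∃ d : Fin 3 → ℂ, (g : Matrix (Fin 3) (Fin 3) ℂ) = Matrix.diagonal d ∧
    ∀ i, IsPrimitiveRoot (d i) k

theorem isPrimitiveDiagonal_of_coe_eq_diagFrac {g : SU3} {k : ℕ} {α : Fin 3 → ℕ} (hk : k ≠ 0)
    (hg : (g : Matrix (Fin 3) (Fin 3) ℂ) = diagFrac k α) (hα : ∀ i, Nat.Coprime k (α i)) :
    IsPrimitiveDiagonal g k :=
  ⟨_, hg, fun i => Complex.isPrimitiveRoot_exp_of_coprime _ _ hk (hα i).symm⟩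

namespace IsPrimitiveDiagonal

variable {g g' : SU3} {k k' : ℕ}

theorem zpowers_le_diagonalRoots (hg : IsPrimitiveDiagonal g k) {N : ℕ} (hN : k ∣ N) :
    Subgroup.zpowers g ≤ diagonalRoots N := by
  obtain ⟨d, h, hd⟩ := hg
  rw [Subgroup.zpowers_le]
  exact ⟨d, h, fun i => ((hd i).pow_eq_one_iff_dvd N).2 hN⟩

theorem orderOf_eq (hg : IsPrimitiveDiagonal g k) : orderOf g = k := by
  obtain ⟨d, h, hd⟩ := hg
  refine Nat.dvd_antisymm (orderOf_dvd_of_pow_eq_one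
    (eq_one_of_coe_eq_diagonal (coe_pow_eq_diagonal h k) fun i => (hd i).pow_eq_one)) ?_
  have h1 := coe_pow_eq_diagonal h (orderOf g)
  rw [pow_orderOf_eq_one] at h1
  have h2 := congrFun (congrFun h1 0) 0
  rw [Matrix.diagonal_apply_eq] at h2
  exact (hd 0).dvd_of_pow_eq_one _ h2.symm

theorem pow (hg : IsPrimitiveDiagonal g k) (hk : 0 < k) {a b : ℕ} (hab : k = a * b) :
    IsPrimitiveDiagonal (g ^ a) b := by
  obtain ⟨d, h, hd⟩ := hg
  exact ⟨_, coe_pow_eq_diagonal h a, fun i => (hd i).pow hk hab⟩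

theorem eq_one_of_smul_eq (hg : IsPrimitiveDiagonal g k) (hk : 0 < k) {γ : SU3}
    (hγ : γ ∈ Subgroup.zpowers g) {z : Fin 3 → ℂ} (hz : z ≠ 0) (hfix : γ • z = z) : γ = 1 := by
  have hfin : IsOfFinOrder g := orderOf_pos_iff.1 (hg.orderOf_eq.symm ▸ hk)
  obtain ⟨n, rfl⟩ := (hfin.mem_powers_iff_mem_zpowers).2 hγ
  have ho := hg.orderOf_eq
  obtain ⟨d, h, hd⟩ := hg
  obtain ⟨i, hi⟩ := Function.ne_iff.1 hz
  have h1 := smul_apply_of_coe_eq_diagonal (coe_pow_eq_diagonal h n) z i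
  simp only at hfix h1
  rw [hfix, eq_comm, mul_eq_right₀ hi] at h1
  exact orderOf_dvd_iff_pow_eq_one.1 (ho.symm ▸ (hd i).dvd_of_pow_eq_one _ h1)

theorem hasOnlyIsolatedSingularities (hg : IsPrimitiveDiagonal g k) (hk : 0 < k) :
    Orbifold.HasOnlyIsolatedSingularities (Subgroup.zpowers g) := by
  have hsing : ∀ p ∈ Orbifold.singularLocus (Subgroup.zpowers g),
      p = Orbifold.proj (Subgroup.zpowers g) 0 := by
    intro p hp
    obtain ⟨z, rfl⟩ := Orbifold.isOpenQuotientMap_proj.surjective p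
    by_contra hz
    have hz0 : z ≠ 0 := fun h => hz (by rw [h])
    exact hp (Orbifold.isSmoothAt_proj
      ((finite_diagonalRoots hk).subset (hg.zpowers_le_diagonalRoots dvd_rfl))
      fun γ hγ h => hg.eq_one_of_smul_eq hk hγ hz0 h)
  exact fun p hp => ⟨Set.univ, isOpen_univ, trivial, fun q _ hq =>
    (hsing q hq).trans (hsing p hp).symm⟩

/-- If the orders are not coprime, some nontrivial element of the group fixes a coordinate axis. -/
theorem exists_ne_one_fixing_axis (hg : IsPrimitiveDiagonal g k) (hg' : IsPrimitiveDiagonal g' k')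
    (hk : 0 < k) (hk' : 0 < k')
    (hdisj : Disjoint (Subgroup.zpowers g) (Subgroup.zpowers g')) (hcop : ¬ Nat.Coprime k k') :
    ∃ h ∈ Subgroup.zpowers g ⊔ Subgroup.zpowers g', h ≠ 1 ∧
      ∀ t : ℂ, h • (![t, 0, 0] : Fin 3 → ℂ) = ![t, 0, 0] := by
  obtain ⟨p, hp, hpk, hpk'⟩ := Nat.Prime.not_coprime_iff_dvd.1 hcop
  have ha := hg.pow hk (Nat.div_mul_cancel hpk).symm
  have hb := hg'.pow hk' (Nat.div_mul_cancel hpk').symm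
  set a := g ^ (k / p)
  set b := g' ^ (k' / p)
  have haG : a ∈ Subgroup.zpowers g := Subgroup.npow_mem_zpowers g _
  have hbG : b ∈ Subgroup.zpowers g' := Subgroup.npow_mem_zpowers g' _
  have hob := hb.orderOf_eq
  obtain ⟨d, hd, hdp⟩ := ha
  obtain ⟨d', hd', hdp'⟩ := hb
  have : NeZero p := ⟨hp.ne_zero⟩
  obtain ⟨i, -, hi⟩ := (hdp 0).eq_pow_of_pow_eq_one (hdp' 0).pow_eq_one
  refine ⟨b⁻¹ * a ^ i, mul_mem (inv_mem (Subgroup.mem_sup_right hbG))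
    (pow_mem (Subgroup.mem_sup_left haG) i), fun h => ?_, fun t => ?_⟩
  · have h1 : b = a ^ i := inv_mul_eq_one.1 h
    have h2 : b = 1 := Subgroup.disjoint_def.1 hdisj (h1 ▸ pow_mem haG i) hbG
    rw [h2, orderOf_one] at hob
    exact hp.one_lt.ne hob
  · rw [mul_smul, inv_smul_eq_iff]
    funext j
    rw [smul_apply_of_coe_eq_diagonal (coe_pow_eq_diagonal hd i),
      smul_apply_of_coe_eq_diagonal hd']
    fin_cases j <;> simp [hi]

theorem not_hasOnlyIsolatedSingularities (hg : IsPrimitiveDiagonal g k)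
    (hg' : IsPrimitiveDiagonal g' k') (hk : 0 < k) (hk' : 0 < k')
    (hdisj : Disjoint (Subgroup.zpowers g) (Subgroup.zpowers g')) (hcop : ¬ Nat.Coprime k k') :
    ¬ Orbifold.HasOnlyIsolatedSingularities (Subgroup.zpowers g ⊔ Subgroup.zpowers g') := by
  set Γ := Subgroup.zpowers g ⊔ Subgroup.zpowers g' with hΓdef
  have hΓ : Γ ≤ diagonalRoots (k * k') :=
    sup_le (hg.zpowers_le_diagonalRoots (dvd_mul_right k k'))
      (hg'.zpowers_le_diagonalRoots (dvd_mul_left k' k))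
  have hN : 0 < k * k' := Nat.mul_pos hk hk'
  obtain ⟨h, hh, hne, hfix⟩ := exists_ne_one_fixing_axis hg hg' hk hk' hdisj hcop
  have hsing : ∀ t : ℂ, t ≠ 0 → Orbifold.proj Γ ![t, 0, 0] ∈ Orbifold.singularLocus Γ := by
    intro t ht
    refine Orbifold.not_isSmoothAt_proj (e := ![0, 1, 0]) (e' := ![0, 0, 1])
      ((finite_diagonalRoots hN).subset hΓ) hh hne (hfix t) fun a b hab γ hγ hγfix => ?_
    obtain ⟨d, hd, -⟩ := hΓ hγ
    have hw : (![t, 0, 0] + a • ![0, 1, 0] + b • ![0, 0, 1] : Fin 3 → ℂ) = ![t, a, b] := by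
      funext i
      fin_cases i <;> simp
    rw [hw] at hγfix
    have hc : ∀ i, (![t, a, b] : Fin 3 → ℂ) i ≠ 0 → d i = 1 := by
      intro i hi
      have h1 := smul_apply_of_coe_eq_diagonal hd ![t, a, b] i
      rwa [hγfix, eq_comm, mul_eq_right₀ hi] at h1
    have hprod := prod_eq_one_of_coe_eq_diagonal hd
    have h0 : d 0 = 1 := hc 0 ht
    have h12 : d 1 = 1 ∧ d 2 = 1 := by
      by_cases ha : a = 0
      · have hb : b ≠ 0 := fun hb => hab (by rw [ha, hb]; rfl)
        have h2 : d 2 = 1 := hc 2 hb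
        exact ⟨by simpa [h0, h2] using hprod, h2⟩
      · have h1 : d 1 = 1 := hc 1 ha
        exact ⟨h1, by simpa [h0, h1] using hprod⟩
    refine eq_one_of_coe_eq_diagonal hd fun i => ?_
    fin_cases i
    exacts [h0, h12.1, h12.2]
  intro hiso
  obtain ⟨U, hU, h1U, hUq⟩ := hiso _ (hsing 1 one_ne_zero)
  have hc : Continuous fun s : ℝ => Orbifold.proj Γ ![(s : ℂ), 0, 0] :=
    Orbifold.isOpenQuotientMap_proj.continuous.comp (by fun_prop)
  have hev : ∀ᶠ s : ℝ in nhds 1, Orbifold.proj Γ ![(s : ℂ), 0, 0] ∈ U :=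
    (hU.preimage hc).mem_nhds (by simpa using h1U)
  obtain ⟨s, hsU, hs⟩ := ((hev.filter_mono nhdsWithin_le_nhds).and
    (self_mem_nhdsWithin : Set.Ioi (1 : ℝ) ∈ nhdsWithin 1 (Set.Ioi 1))).exists
  have hs1 : (1 : ℝ) < s := hs
  have hs0 : (s : ℂ) ≠ 0 := by exact_mod_cast (by linarith : s ≠ 0)
  obtain ⟨γ, hγ, hγs⟩ := Orbifold.proj_eq_proj_iff.1 (hUq _ hsU (hsing s hs0))
  obtain ⟨d, hd, hdN⟩ := hΓ hγ
  have h1 := smul_apply_of_coe_eq_diagonal hd ![1, 0, 0] 0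
  rw [hγs] at h1
  have h2 : (s : ℂ) = d 0 := by simpa using h1
  have h3 : ‖d 0‖ = 1 := Complex.norm_eq_one_of_pow_eq_one (hdN 0) hN.ne'
  rw [← h2, Complex.norm_real, Real.norm_of_nonneg (by linarith)] at h3
  linarith

end IsPrimitiveDiagonal

theorem commute_of_coe_eq_diagonal {g g' : SU3} {d d' : Fin 3 → ℂ}
    (h : (g : Matrix (Fin 3) (Fin 3) ℂ) = Matrix.diagonal d)
    (h' : (g' : Matrix (Fin 3) (Fin 3) ℂ) = Matrix.diagonal d') : Commute g g' := by
  apply Subtype.ext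
  rw [Submonoid.coe_mul, Submonoid.coe_mul, h, h', Matrix.diagonal_mul_diagonal,
    Matrix.diagonal_mul_diagonal]
  simp only [mul_comm]

theorem Commute.mem_zpowers_mul_of_coprime {G : Type*} [Group G] {x y : G} (h : Commute x y)
    (hc : (orderOf x).Coprime (orderOf y)) : x ∈ Subgroup.zpowers (x * y) := by
  obtain ⟨m, hm⟩ := exists_pow_eq_self_of_coprime hc.symm
  have h1 : (x * y) ^ orderOf y = x ^ orderOf y := by
    rw [h.mul_pow, pow_orderOf_eq_one, mul_one]
  refine Subgroup.mem_zpowers_iff.2 ⟨(orderOf y * m : ℕ), ?_⟩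
  rw [zpow_natCast, pow_mul, h1, hm]

theorem Commute.zpowers_sup_zpowers_of_coprime {G : Type*} [Group G] {x y : G} (h : Commute x y)
    (hc : (orderOf x).Coprime (orderOf y)) :
    Subgroup.zpowers x ⊔ Subgroup.zpowers y = Subgroup.zpowers (x * y) := by
  refine le_antisymm (sup_le ?_ ?_) ?_
  · exact Subgroup.zpowers_le.2 (h.mem_zpowers_mul_of_coprime hc)
  · rw [h.eq]
    exact Subgroup.zpowers_le.2 (h.symm.mem_zpowers_mul_of_coprime hc.symm)
  · exact Subgroup.zpowers_le.2 (mul_mem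
      (Subgroup.mem_sup_left (Subgroup.mem_zpowers x))
      (Subgroup.mem_sup_right (Subgroup.mem_zpowers y)))

theorem diagFrac_mul_diagFrac {k k' : ℕ} (hk : k ≠ 0) (hk' : k' ≠ 0) (α α' : Fin 3 → ℕ) :
    diagFrac k α * diagFrac k' α' =
      diagFrac (k * k') fun i => (α i * k' + α' i * k) % (k * k') := by
  simp only [diagFrac, Matrix.diagonal_mul_diagonal, ← Complex.exp_add]
  congr 1
  funext i
  rw [Complex.exp_eq_exp_iff_exists_int]
  have h := congrArg (Nat.cast : ℕ → ℂ) (Nat.mod_add_div (α i * k' + α' i * k) (k * k'))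
  generalize (α i * k' + α' i * k) / (k * k') = q at h
  refine ⟨q, ?_⟩
  push_cast at h
  have hkC : (k : ℂ) ≠ 0 := by exact_mod_cast hk
  have hkC' : (k' : ℂ) ≠ 0 := by exact_mod_cast hk'
  push_cast
  field_simp
  linear_combination -h

theorem coprime_mul_mod {k k' a a' : ℕ} (hkk : Nat.Coprime k k') (ha : Nat.Coprime k a)
    (ha' : Nat.Coprime k' a') : Nat.Coprime (k * k') ((a * k' + a' * k) % (k * k')) := by
  rw [Nat.Coprime, Nat.gcd_comm, ← Nat.gcd_rec]
  refine Nat.Coprime.mul_left ?_ ?_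
  · rw [Nat.coprime_add_mul_right_right]
    exact ha.mul_right hkk
  · rw [add_comm, Nat.coprime_add_mul_right_right]
    exact ha'.mul_right hkk.symm

theorem mainTheorem3 (k k' : ℕ) (α α' : Fin 3 → ℕ) (g g' : SU3)
    (hg : (g : Matrix (Fin 3) (Fin 3) ℂ) = diagFrac k α)
    (hg' : (g' : Matrix (Fin 3) (Fin 3) ℂ) = diagFrac k' α')
    (hα : ∀ i, 0 < α i ∧ α i < k) (hα' : ∀ i, 0 < α' i ∧ α' i < k')
    (hk : Odd k) (hk' : Odd k')
    (hcop : ∀ i, Nat.Coprime k (α i)) (hcop' : ∀ i, Nat.Coprime k' (α' i)) :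
    (Disjoint (Subgroup.zpowers g) (Subgroup.zpowers g') →
      (Orbifold.HasOnlyIsolatedSingularities (Subgroup.zpowers g ⊔ Subgroup.zpowers g') ↔
        Nat.Coprime k k')) ∧
    (Nat.Coprime k k' →
      Disjoint (Subgroup.zpowers g) (Subgroup.zpowers g') ∧
      Orbifold.HasOnlyIsolatedSingularities (Subgroup.zpowers g ⊔ Subgroup.zpowers g') ∧
      Nonempty (↥(Subgroup.zpowers g ⊔ Subgroup.zpowers g') ≃*
        Multiplicative (ZMod (k * k'))) ∧
      ∃ (γ : Fin 3 → ℕ) (h : SU3),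
        (h : Matrix (Fin 3) (Fin 3) ℂ) = diagFrac (k * k') γ ∧
        Subgroup.zpowers g ⊔ Subgroup.zpowers g' = Subgroup.zpowers h ∧
        ∀ i, 0 < γ i ∧ γ i < k * k' ∧ Nat.Coprime (k * k') (γ i)) := by
  have hk1 : 1 < k := lt_of_le_of_lt (hα 0).1 (hα 0).2
  have hk1' : 1 < k' := lt_of_le_of_lt (hα' 0).1 (hα' 0).2
  have hk0 : 0 < k := hk.pos
  have hk0' : 0 < k' := hk'.pos
  have hN1 : 1 < k * k' := Nat.one_lt_mul_iff.2 ⟨hk0, hk0', Or.inl hk1⟩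
  have hN : 0 < k * k' := Nat.mul_pos hk0 hk0'
  have hgP := isPrimitiveDiagonal_of_coe_eq_diagFrac hk0.ne' hg hcop
  have hgP' := isPrimitiveDiagonal_of_coe_eq_diagFrac hk0'.ne' hg' hcop'
  have hcomm : Commute g g' := commute_of_coe_eq_diagonal hg hg'
  set γ : Fin 3 → ℕ := fun i => (α i * k' + α' i * k) % (k * k') with hγ
  have hmul : ((g * g' : SU3) : Matrix (Fin 3) (Fin 3) ℂ) = diagFrac (k * k') γ := by
    rw [Submonoid.coe_mul, hg, hg', diagFrac_mul_diagFrac hk0.ne' hk0'.ne']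
  have hγc : Nat.Coprime k k' → ∀ i, Nat.Coprime (k * k') (γ i) := fun h i =>
    coprime_mul_mod h (hcop i) (hcop' i)
  have hP : Nat.Coprime k k' → IsPrimitiveDiagonal (g * g') (k * k') := fun h =>
    isPrimitiveDiagonal_of_coe_eq_diagFrac hN.ne' hmul (hγc h)
  have hsup : Nat.Coprime k k' →
      Subgroup.zpowers g ⊔ Subgroup.zpowers g' = Subgroup.zpowers (g * g') := fun h =>
    hcomm.zpowers_sup_zpowers_of_coprime (by rwa [hgP.orderOf_eq, hgP'.orderOf_eq])
  have hiso : Nat.Coprime k k' →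
      Orbifold.HasOnlyIsolatedSingularities (Subgroup.zpowers g ⊔ Subgroup.zpowers g') :=
    fun h => by
      rw [hsup h]
      exact (hP h).hasOnlyIsolatedSingularities hN
  refine ⟨fun hdisj => ⟨fun h => ?_, hiso⟩, fun h => ⟨?_, hiso h, ?_, γ, g * g', hmul, hsup h,
    fun i => ⟨Nat.pos_of_ne_zero fun h0 => ?_, Nat.mod_lt _ hN, hγc h i⟩⟩⟩
  · by_contra hnc
    exact hgP.not_hasOnlyIsolatedSingularities hgP' hk0 hk0' hdisj hnc h
  · apply Subgroup.disjoint_of_coprime_natCard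
    rwa [Nat.card_zpowers, Nat.card_zpowers, hgP.orderOf_eq, hgP'.orderOf_eq]
  · rw [hsup h]
    have hcard : Nat.card (Subgroup.zpowers (g * g')) = k * k' := by
      rw [Nat.card_zpowers, (hP h).orderOf_eq]
    exact ⟨mulEquivOfCyclicCardEq (by rw [hcard, Nat.card_congr Multiplicative.toAdd,
      Nat.card_zmod])⟩
  · have := hγc h i
    rw [h0, Nat.coprime_zero_right] at this
    exact hN1.ne' this
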